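/- Let $K\ge 1$, $R\ge 0$, and $\mathbf d=(d_1,\dots,d_K)$ with all $d_k\ge 1$. For $\mathbf n=(n_1,\dots,n_K)$ let the Segre–Veronese manifold $\mathcal{SV}_{\mathbf n,\mathbf d}$ be the set of real tensors $\alpha\,\mathbf a_1^{\otimes d_1}\otimes\cdots\otimes\mathbf a_K^{\otimes d_K}$ with $\alpha\in\mathbb R\setminus\{0\}$ and unit vectors $\mathbf a_k\in\mathbb R^{n_k}$. For a set $\mathcal M$ in a Euclidean space and $\mathfrak a=(A_1,\dots,A_R)\in\mathcal M^{\times R}$ with $A=A_1+\cdots+A_R$, let $\Sigma:\mathcal M^{\times R}\to\mathbb R^N$ be the addition map. Let $$\kappa_{\mathcal M}(A_1,\dots,A_R)=\lim_{\delta\to0}\ \sup_{\widetilde A\in\mathcal D,\ 0<\|A-\widetilde A\|\le\delta}\frac{\|\Sigma_{\mathfrak a}^{-1}(A)-\Sigma_{\mathfrak a}^{-1}(\widetilde A)\|}{\|A-\widetilde A\|}\in[0,\infty],$$ where $\Sigma_{\mathfrak a}^{-1}:\mathcal D\to\mathcal M^{\times R}$ is a continuous local inverse of $\Sigma$ at $\mathfrak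 a$, defined on the image $\mathcal D=\Sigma(\mathcal U)$ of a neighbourhood $\mathcal U$ of $\mathfrak a$ in $\mathcal M^{\times R}$, and all norms are Euclidean (Frobenius); the value does not depend on $\mathcal U$, and $\kappa_{\mathcal M}:=\infty$ if there is no such local inverse. **Theorem.** Let $G_1,\dots,G_R\in\mathcal{SV}_{\mathbf m,\mathbf d}$. For $k=1,\dots,K$ let $Q_k\in\mathbb R^{n_k\times m_k}$ have orthonormal columns, and set $A_r:=(Q_1^{\otimes d_1}\otimes\cdots\otimes Q_K^{\otimes d_K})\,G_r$ for $r=1,\dots,R$. Then $$\kappa_{\mathcal{SV}_{\mathbf n,\mathbf d}}(A_1,\dots,A_R)\le\sqrt{\max_k d_k}\;\kappa_{\mathcal{SV}_{\mathbf m,\mathbf d}}(G_1,\dots,G_R).$$ Moreover, for $k=1,\dots,K$ let $U_k\in\mathbb R^{\ell_k\times m_k}$ have orthonormal columns, and set $B_r:=(U_1^{\otimes d_1}\otimes\cdots\otimes U_K^{\otimes d_K})\,G_r$. If $\min(\ell_k,n_k)>m_k$ for all $k$, then $$\kappa_{\mathcal{SV}_{\mathbf n,\mathbf d}}(A_1,\dots,A_R)=\kappa_{\mathcal{SV}_{\boldsymbol\ell,\mathbf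 d}}(B_1,\dots,B_R).$$ -/

import Mathlib

open scoped ENNReal Topology Matrix

noncomputable section

/-! ### The condition number of a join decomposition -/

section Condition

variable {E : Type*} [NormedAddCommGroup E] {R : ℕ}

/-- The `R`-fold product `M × ⋯ × M`, inside `E × ⋯ × E` with the Euclidean product norm. -/
def prodSet (M : Set E) (R : ℕ) : Set (PiLp 2 fun _ : Fin R => E) :=
  {x | ∀ r, x r ∈ M}

/-- The addition map `(A₁, …, A_R) ↦ A₁ + ⋯ + A_R`. -/
def addMap (x : PiLp 2 fun _ : Fin R => E) : E := ∑ r, x r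

/-- `s` is a (continuous) local inverse at `a` of the addition map restricted to `M × ⋯ × M`:
it is defined on the image `addMap '' U` of a neighbourhood `U` of `a` in `M × ⋯ × M` and
inverts the addition map on `U`. -/
structure IsLocalInverse (M : Set E) (a : PiLp 2 fun _ : Fin R => E)
    (U : Set (PiLp 2 fun _ : Fin R => E)) (s : E → PiLp 2 fun _ : Fin R => E) : Prop where
  mem : a ∈ U
  subset : U ⊆ prodSet M R
  mem_nhdsWithin : U ∈ 𝓝[prodSet M R] a
  leftInv : ∀ x ∈ U, s (addMap x) = x
  continuousOn : ContinuousOn s (addMap '' U)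

/-- The (absolute, worst case, asymptotic) condition number at `A` of a map `s` defined on `D`:
the limit as `δ → 0` of the supremum of `‖s A - s B‖ / ‖A - B‖` over the points `B ≠ A` of `D`
with `‖A - B‖ ≤ δ`. The supremum is monotone in `δ`, so the limit is an infimum. -/
def mapCondition {F : Type*} [NormedAddCommGroup F] (D : Set E) (s : E → F) (A : E) : ℝ≥0∞ :=
  ⨅ (δ : ℝ) (_ : 0 < δ), ⨆ B ∈ {B | B ∈ D ∧ B ≠ A ∧ ‖A - B‖ ≤ δ}, ‖s A - s B‖ₑ / ‖A - B‖ₑ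

/-- The condition number of the join decomposition `a = (A₁, …, A_R)` with summands in `M`: the
condition number at `A₁ + ⋯ + A_R` of a local inverse at `a` of the addition map on
`M × ⋯ × M`, and `∞` if there is no local inverse (in particular if `a` is not isolated).
All local inverses give the same value (`condNumber_eq` below), so the infimum only selects it. -/
def condNumber (M : Set E) (a : PiLp 2 fun _ : Fin R => E) : ℝ≥0∞ :=
  ⨅ (U) (s) (_ : IsLocalInverse M a U s), mapCondition (addMap '' U) s (addMap a)

theorem mapCondition_le {M : Set E} {a : PiLp 2 fun _ : Fin R => E}
    {U U' : Set (PiLp 2 fun _ : Fin R => E)} {s s' : E → PiLp 2 fun _ : Fin R => E}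
    (h : IsLocalInverse M a U s) (h' : IsLocalInverse M a U' s') :
    mapCondition (addMap '' U) s (addMap a) ≤ mapCondition (addMap '' U') s' (addMap a) := by
  have hA : s (addMap a) = a := h.leftInv a h.mem
  have hA' : s' (addMap a) = a := h'.leftInv a h'.mem
  have hc : Filter.Tendsto s (𝓝[addMap '' U] (addMap a)) (𝓝[prodSet M R] a) := by
    refine tendsto_nhdsWithin_iff.2 ⟨?_, ?_⟩
    · have := h.continuousOn (addMap a) ⟨a, h.mem, rfl⟩
      rwa [ContinuousWithinAt, hA] at this
    · filter_upwards [self_mem_nhdsWithin]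
      rintro _ ⟨x, hx, rfl⟩
      rw [h.leftInv x hx]
      exact h.subset hx
  obtain ⟨ε, hε, hb⟩ := Metric.mem_nhdsWithin_iff.1 (hc h'.mem_nhdsWithin)
  refine le_iInf₂ fun δ hδ => ?_
  refine (iInf₂_le (min δ (ε / 2)) (lt_min hδ (half_pos hε))).trans ?_
  refine iSup₂_le ?_
  rintro _ ⟨⟨x, hx, rfl⟩, hne, hle⟩
  have hx' : x ∈ U' := by
    have : addMap x ∈ s ⁻¹' U' := by
      refine hb ⟨?_, x, hx, rfl⟩
      rw [Metric.mem_ball, dist_comm, dist_eq_norm]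
      have := hle.trans (min_le_right _ _)
      linarith
    rwa [Set.mem_preimage, h.leftInv x hx] at this
  rw [hA, h.leftInv x hx]
  refine le_trans ?_ (le_iSup₂ (addMap x) ⟨⟨x, hx', rfl⟩, hne, hle.trans (min_le_left _ _)⟩)
  rw [hA', h'.leftInv x hx']

theorem condNumber_eq {M : Set E} {a : PiLp 2 fun _ : Fin R => E}
    {U : Set (PiLp 2 fun _ : Fin R => E)} {s : E → PiLp 2 fun _ : Fin R => E}
    (h : IsLocalInverse M a U s) :
    condNumber M a = mapCondition (addMap '' U) s (addMap a) :=
  le_antisymm (iInf_le_of_le U (iInf_le_of_le s (iInf_le_of_le h le_rfl)))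
    (le_iInf fun _ => le_iInf fun _ => le_iInf fun h' => mapCondition_le h h')

end Condition

/-! ### Segre–Veronese manifolds -/

section SegreVeronese

variable {K : ℕ}

/-- Real tensors with `d k` indices ranging over `{1, …, n k}`, for each `k`, with the Frobenius
norm. -/
abbrev MixedTensor (n d : Fin K → ℕ) : Type :=
  EuclideanSpace ℝ ((k : Fin K) → Fin (d k) → Fin (n k))

/-- The tensor `α a₁^{⊗ d₁} ⊗ ⋯ ⊗ a_K^{⊗ d_K}`. -/
def rankOneTensor (n d : Fin K → ℕ) (α : ℝ) (a : (k : Fin K) → EuclideanSpace ℝ (Fin (n k))) :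
    MixedTensor n d :=
  WithLp.toLp 2 fun i => α * ∏ k, ∏ t, a k (i k t)

/-- The Segre–Veronese manifold of nonzero partially symmetric tensors of rank one. -/
def segreVeronese (n d : Fin K → ℕ) : Set (MixedTensor n d) :=
  {A | ∃ (α : ℝ) (a : (k : Fin K) → EuclideanSpace ℝ (Fin (n k))),
    α ≠ 0 ∧ (∀ k, ‖a k‖ = 1) ∧ A = rankOneTensor n d α a}

/-- The action `(Q₁^{⊗ d₁} ⊗ ⋯ ⊗ Q_K^{⊗ d_K}) G` of matrices on a tensor. -/
def multilinearMul {m n : Fin K → ℕ} (d : Fin K → ℕ)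
    (Q : (k : Fin K) → Matrix (Fin (n k)) (Fin (m k)) ℝ) (G : MixedTensor m d) :
    MixedTensor n d :=
  WithLp.toLp 2 fun i => ∑ j, (∏ k, ∏ t, Q k (i k t) (j k t)) * G j

end SegreVeronese

end

noncomputable section

/-! ### Condition numbers and injectivity bounds for the differential of the addition map -/

section ConditionBounds

variable {E : Type*} [NormedAddCommGroup E] {R : ℕ}

/-! The condition number is in essence the reciprocal of the smallest singular value of the addition
map on the product of the tangent spaces. The two halves of this are `TerraciniBound.condNumber_le`
and `terraciniBound_of_condNumber_lt`; they turn the theorem into a comparison of constants `c` in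
`c * ∑ ‖t r‖² ≤ ‖∑ t r‖²` over tangent vectors `t r`.

A tangent direction at `A r` has the form `Q c + w` with `Qᵀ w = 0`. By `norm_sum_tangentVec_add_sq`
the sum of the tangent vectors splits orthogonally into an isometric copy of the one for `G` and,
for each slot `s`, a tensor carrying the vectors `w` in slot `s`. The latter is controlled by the
Gram matrix of the elementary tensors with slot `s` deleted. So a bound `c` for `G` together with
Gram bounds `c` for all slots gives the bound `c` for the image (`TerraciniBound.map`).

The Gram bounds come from testing the tangent bound with one common unit vector `u` in the `k`-th
factor, which produces `d k` terms, one per slot. In general Cauchy–Schwarz on these terms gives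
only `c / d k` (`TerraciniBound.gramBound`), whence the factor `√(max d)`. If the ambient space is
strictly larger, `u` can be taken orthogonal to the range of the isometry; the terms are then
orthogonal and nothing is lost (`TerraciniBound.gramBound_of_lt`). The bound in a strictly larger
space is thus equivalent to conditions on `G` alone, which gives the equality. -/

theorem condNumber_le_of_antilipschitz {M : Set E} {a : PiLp 2 fun _ : Fin R => E}
    (ha : a ∈ prodSet M R) {c : ℝ} (hc : 0 < c)
    (h : ∀ᶠ p in 𝓝 (a, a), p.1 ∈ prodSet M R → p.2 ∈ prodSet M R →
      c * ‖p.1 - p.2‖ ≤ ‖addMap p.1 - addMap p.2‖) :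
    condNumber M a ≤ ENNReal.ofReal (1 / c) := by
  classical
  obtain ⟨W, hW, h⟩ : ∃ W ∈ 𝓝 a, ∀ x ∈ W, ∀ y ∈ W, x ∈ prodSet M R → y ∈ prodSet M R →
      c * ‖x - y‖ ≤ ‖addMap x - addMap y‖ := by
    obtain ⟨W, hW, h⟩ := Filter.mem_prod_same_iff.1 (nhds_prod_eq (x := a) (y := a) ▸ h)
    exact ⟨W, hW, fun x hx y hy => h (Set.mk_mem_prod hx hy)⟩
  set U : Set (PiLp 2 fun _ : Fin R => E) := prodSet M R ∩ W with hU
  have hb : ∀ x ∈ U, ∀ y ∈ U, c * ‖x - y‖ ≤ ‖addMap x - addMap y‖ := fun x hx y hy =>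
    h x hx.2 y hy.2 hx.1 hy.1
  have haU : a ∈ U := ⟨ha, mem_of_mem_nhds hW⟩
  have hinj : Set.InjOn (addMap (E := E) (R := R)) U := by
    intro x hx y hy hxy
    have h1 := hb x hx y hy
    rw [hxy, sub_self, norm_zero] at h1
    have h2 : ‖x - y‖ ≤ 0 := by
      by_contra! h3
      nlinarith [mul_pos hc h3]
    exact sub_eq_zero.1 (norm_le_zero_iff.1 h2)
  have hinv : ∀ x ∈ U, Function.invFunOn addMap U (addMap x) = x := fun x hx =>
    hinj.leftInvOn_invFunOn hx
  have hloc : IsLocalInverse M a U (Function.invFunOn addMap U) := by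
    refine ⟨haU, Set.inter_subset_left, ?_, hinv, ?_⟩
    · exact inter_mem_nhdsWithin _ hW
    -- The lower bound on the addition map says that its inverse is `1 / c`-Lipschitz, hence
    -- continuous.
    · have : LipschitzOnWith (Real.toNNReal (1 / c)) (Function.invFunOn addMap U)
          ((addMap (E := E) (R := R)) '' U) := by
        refine LipschitzOnWith.of_dist_le_mul ?_
        rintro _ ⟨x, hx, rfl⟩ _ ⟨y, hy, rfl⟩
        rw [hinv x hx, hinv y hy, dist_eq_norm, dist_eq_norm,
          Real.coe_toNNReal _ (by positivity), div_mul_eq_mul_div, one_mul, le_div_iff₀ hc]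
        linarith [hb x hx y hy]
      exact this.continuousOn
  rw [condNumber_eq hloc]
  refine (iInf₂_le 1 one_pos).trans (iSup₂_le ?_)
  rintro _ ⟨⟨x, hx, rfl⟩, hne, -⟩
  rw [hinv x hx, hinv a haU]
  have hpos : 0 < ‖addMap a - addMap x‖ := norm_pos_iff.2 (sub_ne_zero.2 hne.symm)
  rw [← ofReal_norm, ← ofReal_norm, ← ENNReal.ofReal_div_of_pos hpos]
  refine ENNReal.ofReal_le_ofReal ?_
  rw [div_le_div_iff₀ hpos hc]
  linarith [hb a haU x hx]

variable [NormedSpace ℝ E]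

/-- The addition map as a continuous linear map. -/
def addMapL (E : Type*) [NormedAddCommGroup E] [NormedSpace ℝ E] (R : ℕ) :
    (PiLp 2 fun _ : Fin R => E) →L[ℝ] E :=
  ∑ r, PiLp.proj 2 (fun _ : Fin R => E) r

theorem addMapL_apply (x : PiLp 2 fun _ : Fin R => E) : addMapL E R x = addMap x := by
  simp [addMapL, addMap]

/-- If every point of `M` near `a r` is fixed by a map `P r`, and the addition map is bounded below
by `c` on the products of the ranges of the derivatives of the `P r`, then the condition
number at `a` is at most `1 / c`. -/
theorem condNumber_le_of_hasStrictFDerivAt {M : Set E} {a : PiLp 2 fun _ : Fin R => E}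
    (ha : a ∈ prodSet M R) {P : Fin R → E → E} {P' : Fin R → E →L[ℝ] E}
    (hP : ∀ r, HasStrictFDerivAt (P r) (P' r) (a r))
    (hfix : ∀ r, ∀ᶠ x in 𝓝 (a r), x ∈ M → P r x = x) {c : ℝ} (hc : 0 < c)
    (h : ∀ v : PiLp 2 fun _ : Fin R => E,
      c * ‖WithLp.toLp 2 fun r => P' r (v r)‖ ≤ ‖∑ r, P' r (v r)‖) :
    condNumber M a ≤ ENNReal.ofReal (1 / c) := by
  -- Linearization loses an arbitrarily small part of `c`, so the estimate is proved for each `c' <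
  -- c` and then passed to the limit.
  have key : ∀ c' ∈ Set.Ioo 0 c, condNumber M a ≤ ENNReal.ofReal (1 / c') := by
    rintro c' ⟨hc'0, hc'⟩
    refine condNumber_le_of_antilipschitz ha hc'0 ?_
    set F : (PiLp 2 fun _ : Fin R => E) → PiLp 2 fun _ : Fin R => E :=
      fun x => WithLp.toLp 2 fun r => P r (x r)
    set L : (PiLp 2 fun _ : Fin R => E) →L[ℝ] PiLp 2 fun _ : Fin R => E :=
      (PiLp.continuousLinearEquiv 2 ℝ (fun _ : Fin R => E)).symm.toContinuousLinearMap.comp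
        (ContinuousLinearMap.pi fun r => (P' r).comp (PiLp.proj 2 (fun _ : Fin R => E) r))
    have hL : ∀ v, L v = WithLp.toLp 2 fun r => P' r (v r) := fun v => rfl
    have hF : HasStrictFDerivAt F L a := by
      rw [hasStrictFDerivAt_piLp]
      intro r
      have h1 : HasStrictFDerivAt (fun x : PiLp 2 fun _ : Fin R => E => x r)
          (PiLp.proj 2 (fun _ : Fin R => E) r) a :=
        (PiLp.proj 2 (𝕜 := ℝ) (fun _ : Fin R => E) r).hasStrictFDerivAt
      exact (hP r).comp a h1
    set B := ‖addMapL E R‖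
    have hB : 0 ≤ B := norm_nonneg _
    -- Replacing `v` by `L v` costs `c * ε * ‖v‖` in the norm of `v` and `B * ε * ‖v‖` in the norm
    -- of its sum; this `ε` makes the total loss `(c - c') * ‖v‖`.
    set ε := (c - c') / (c + B) with hε
    have hεpos : 0 < ε := div_pos (by linarith) (by linarith)
    have hεeq : ε * (c + B) = c - c' := div_mul_cancel₀ _ (by linarith)
    have hlo := hF.isLittleO.def hεpos
    have hfix' : ∀ᶠ x in 𝓝 a, x ∈ prodSet M R → F x = x := by
      have : ∀ᶠ x in 𝓝 a, ∀ r, x r ∈ M → P r (x r) = x r := by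
        rw [Filter.eventually_all]
        intro r
        have hcont : Filter.Tendsto (fun x : PiLp 2 fun _ : Fin R => E => x r) (𝓝 a) (𝓝 (a r)) :=
          (PiLp.proj 2 (𝕜 := ℝ) (fun _ : Fin R => E) r).continuous.tendsto a
        exact hcont.eventually (hfix r)
      filter_upwards [this] with x hx hxM
      ext r
      exact hx r (hxM r)
    have h2 := hfix'.prod_mk hfix'
    rw [← nhds_prod_eq] at h2
    filter_upwards [hlo, h2] with p hp hp2 hp3 hp4
    rw [hp2.1 hp3, hp2.2 hp4] at hp
    -- On `M × ⋯ × M` the map `F` is the identity, so strict differentiability now reads `‖v - L v‖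
    -- ≤ ε * ‖v‖` for differences `v` of nearby points.
    rw [← addMapL_apply, ← addMapL_apply, ← map_sub]
    set v := p.1 - p.2
    have h3 : c * ‖L v‖ ≤ ‖addMapL E R (L v)‖ := by
      rw [addMapL_apply, hL]
      exact h v
    have h4 : ‖addMapL E R (L v)‖ ≤ ‖addMapL E R v‖ + B * (ε * ‖v‖) := by
      have e : addMapL E R (L v) = addMapL E R v - addMapL E R (v - L v) := by
        rw [map_sub _ v, sub_sub_cancel]
      rw [e]
      refine (norm_sub_le _ _).trans ?_
      gcongr
      exact ((addMapL E R).le_opNorm _).trans (by gcongr)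
    have h5 : ‖v‖ ≤ ‖L v‖ + ε * ‖v‖ := by
      have e : v = L v + (v - L v) := by abel
      calc ‖v‖ = ‖L v + (v - L v)‖ := by rw [← e]
        _ ≤ ‖L v‖ + ‖v - L v‖ := norm_add_le _ _
        _ ≤ _ := by gcongr
    have h6 : c * ‖v‖ ≤ c * (‖L v‖ + ε * ‖v‖) := by gcongr
    have h7 : c' * ‖v‖ = c * ‖v‖ - ε * (c + B) * ‖v‖ := by rw [hεeq]; ring
    rw [h7]
    linarith
  have hlim : Filter.Tendsto (fun c' : ℝ => ENNReal.ofReal (1 / c')) (𝓝[<] c)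
      (𝓝 (ENNReal.ofReal (1 / c))) := by
    refine ENNReal.tendsto_ofReal (Filter.Tendsto.mono_left ?_ nhdsWithin_le_nhds)
    exact tendsto_const_nhds.div Filter.tendsto_id hc.ne'
  refine ge_of_tendsto hlim ?_
  filter_upwards [Ioo_mem_nhdsLT hc] with c' hc' using key c' hc'

/-- A condition number less than `C` bounds below the addition map along the velocities of curves
in `M × ⋯ × M`. -/
theorem norm_deriv_le_of_condNumber_lt {M : Set E} {a : PiLp 2 fun _ : Fin R => E} {C : ℝ}
    (h : condNumber M a < ENNReal.ofReal C) {γ : ℝ → PiLp 2 fun _ : Fin R => E}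
    {t : PiLp 2 fun _ : Fin R => E} (hγ : HasDerivAt γ t 0) (h0 : γ 0 = a)
    (hM : ∀ᶠ τ in 𝓝 0, γ τ ∈ prodSet M R) :
    ‖t‖ ≤ C * ‖addMap t‖ := by
  have hC : 0 < C := ENNReal.ofReal_pos.1 (pos_of_gt h)
  obtain ⟨U, h⟩ := iInf_lt_iff.1 h
  obtain ⟨s, h⟩ := iInf_lt_iff.1 h
  obtain ⟨hU, h⟩ := iInf_lt_iff.1 h
  obtain ⟨δ, h⟩ := iInf_lt_iff.1 h
  obtain ⟨hδ, h⟩ := iInf_lt_iff.1 h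
  have hγc : Filter.Tendsto γ (𝓝 0) (𝓝 a) := h0 ▸ hγ.continuousAt
  have hγM : Filter.Tendsto γ (𝓝 0) (𝓝[prodSet M R] a) := tendsto_nhdsWithin_iff.2 ⟨hγc, hM⟩
  have hγU : ∀ᶠ τ in 𝓝 0, γ τ ∈ U := hγM hU.mem_nhdsWithin
  have hclose : ∀ᶠ τ in 𝓝 0, ‖addMap a - addMap (γ τ)‖ < δ := by
    have h1 : Filter.Tendsto (fun τ => ‖addMapL E R a - addMapL E R (γ τ)‖) (𝓝 0) (𝓝 0) := by
      have := (((addMapL E R).continuous.tendsto a).comp hγc).const_sub (addMapL E R a)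
      simpa using this.norm
    simp only [addMapL_apply] at h1
    exact h1.eventually_lt_const hδ
  have hmain : ∀ᶠ τ in 𝓝 (0 : ℝ), ‖γ τ - γ 0‖ ≤ C * ‖addMap (γ τ) - addMap (γ 0)‖ := by
    filter_upwards [hγU, hclose] with τ hτ hτδ
    rw [h0]
    -- The supremum excludes points with the same sum as `a`; for these the local inverse forces `γ
    -- τ = a`.
    by_cases hne : addMap (γ τ) = addMap a
    · have : γ τ = a := by
        rw [← hU.leftInv _ hτ, hne, hU.leftInv _ hU.mem]
      simp [this]
    · have h1 := (le_iSup₂ (f := fun B (_ : B ∈ {B | B ∈ addMap '' U ∧ B ≠ addMap a ∧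
          ‖addMap a - B‖ ≤ δ}) => ‖s (addMap a) - s B‖ₑ / ‖addMap a - B‖ₑ)
          (addMap (γ τ)) ⟨⟨_, hτ, rfl⟩, hne, hτδ.le⟩).trans h.le
      have hpos : 0 < ‖addMap a - addMap (γ τ)‖ :=
        norm_pos_iff.2 (sub_ne_zero.2 fun e => hne e.symm)
      rw [hU.leftInv _ hτ, hU.leftInv _ hU.mem, ← ofReal_norm, ← ofReal_norm,
        ← ENNReal.ofReal_div_of_pos hpos, ENNReal.ofReal_le_ofReal_iff hC.le,
        div_le_iff₀ hpos] at h1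
      rwa [norm_sub_rev, norm_sub_rev (addMap (γ τ))]
  have hl : Filter.Tendsto (fun τ => slope γ 0 τ) (𝓝[≠] 0) (𝓝 t) :=
    hasDerivAt_iff_tendsto_slope.1 hγ
  have hr : Filter.Tendsto (fun τ => C * ‖addMapL E R (slope γ 0 τ)‖) (𝓝[≠] 0)
      (𝓝 (C * ‖addMapL E R t‖)) :=
    ((((addMapL E R).continuous.tendsto t).comp hl).norm).const_mul C
  rw [← addMapL_apply]
  refine le_of_tendsto_of_tendsto hl.norm hr ?_
  filter_upwards [hmain.filter_mono nhdsWithin_le_nhds] with τ hτ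
  rw [slope_def_module, map_smul, map_sub, norm_smul, norm_smul, addMapL_apply, addMapL_apply,
    mul_left_comm]
  gcongr

theorem hasDerivAt_toLp {ι E : Type*} [Fintype ι] [NormedAddCommGroup E] [NormedSpace ℝ E]
    {γ : ι → ℝ → E} {t : ι → E} {τ : ℝ} (h : ∀ i, HasDerivAt (γ i) (t i) τ) :
    HasDerivAt (fun τ => (WithLp.toLp 2 fun i => γ i τ : PiLp 2 fun _ : ι => E))
      (WithLp.toLp 2 t) τ :=
  (PiLp.continuousLinearEquiv 2 ℝ fun _ : ι => E).symm.toContinuousLinearMap.hasFDerivAt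
    |>.comp_hasDerivAt τ (hasDerivAt_pi.2 h)

theorem sum_norm_deriv_sq_le_of_condNumber_lt {M : Set E} {a : Fin R → E} {C : ℝ}
    (h : condNumber M (WithLp.toLp 2 a) < ENNReal.ofReal C) {γ : Fin R → ℝ → E} {t : Fin R → E}
    (hγ : ∀ r, HasDerivAt (γ r) (t r) 0) (h0 : ∀ r, γ r 0 = a r)
    (hM : ∀ r, ∀ᶠ τ in 𝓝 0, γ r τ ∈ M) :
    ∑ r, ‖t r‖ ^ 2 ≤ C ^ 2 * ‖∑ r, t r‖ ^ 2 := by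
  have hle := norm_deriv_le_of_condNumber_lt h (hasDerivAt_toLp hγ) (by simp only [h0])
    (by
      filter_upwards [Filter.eventually_all.2 hM] with τ hτ
      exact hτ)
  have hsq := pow_le_pow_left₀ (norm_nonneg _) hle 2
  rw [mul_pow, PiLp.norm_sq_eq_of_L2] at hsq
  exact hsq

end ConditionBounds
end

noncomputable section

/-! ### Elementary tensors -/

section Elementary

variable {K : ℕ}

open Finset

/-- The positions of the indices of a tensor of format `d`. -/
abbrev Slot (d : Fin K → ℕ) : Type := (k : Fin K) × Fin (d k)

theorem prod_update_apply {n d : Fin K → ℕ} (v : (s : Slot d) → EuclideanSpace ℝ (Fin (n s.1)))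
    (s : Slot d) (x : EuclideanSpace ℝ (Fin (n s.1)))
    (i : (k : Fin K) → Fin (d k) → Fin (n k)) :
    ∏ s', Function.update v s x s' (i s'.1 s'.2) =
      x (i s.1 s.2) * ∏ s' ∈ univ.erase s, v s' (i s'.1 s'.2) := by
  rw [← mul_prod_erase univ _ (mem_univ s), Function.update_self]
  congr 1
  exact prod_congr rfl fun s' hs' => by rw [Function.update_of_ne (ne_of_mem_erase hs')]

/-- The elementary tensor with a separate vector in every slot, as a multilinear map. -/
def elem (n d : Fin K → ℕ) :
    ContinuousMultilinearMap ℝ (fun s : Slot d => EuclideanSpace ℝ (Fin (n s.1)))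
      (MixedTensor n d) where
  toFun v := WithLp.toLp 2 fun i => ∏ s : Slot d, v s (i s.1 s.2)
  map_update_add' := by
    intro inst v s x y
    obtain rfl : inst = instDecidableEqSigma := Subsingleton.elim _ _
    ext i
    rw [PiLp.add_apply]
    simp only [prod_update_apply, PiLp.add_apply, add_mul]
  map_update_smul' := by
    intro inst v s c x
    obtain rfl : inst = instDecidableEqSigma := Subsingleton.elim _ _
    ext i
    rw [PiLp.smul_apply]
    simp only [prod_update_apply, PiLp.smul_apply, smul_eq_mul, mul_assoc]
  cont := by
    refine (PiLp.continuous_toLp 2 _).comp (continuous_pi fun i => ?_)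
    fun_prop

theorem elem_apply {n d : Fin K → ℕ} (v : (s : Slot d) → EuclideanSpace ℝ (Fin (n s.1)))
    (i : (k : Fin K) → Fin (d k) → Fin (n k)) :
    elem n d v i = ∏ s : Slot d, v s (i s.1 s.2) := rfl

/-- Distributivity of products over sums, once a multi-index is uncurried to a function on slots.
Inner products and matrix actions on elementary tensors factor over slots because of it. -/
theorem sum_prod_slot {n d : Fin K → ℕ} (f : (s : Slot d) → Fin (n s.1) → ℝ) :
    ∑ i : (k : Fin K) → Fin (d k) → Fin (n k), ∏ s : Slot d, f s (i s.1 s.2) =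
      ∏ s : Slot d, ∑ j, f s j := by
  rw [prod_univ_sum, Fintype.piFinset_univ]
  exact Fintype.sum_equiv (Equiv.piCurry fun k (_ : Fin (d k)) => Fin (n k)).symm _ _ fun i => rfl

theorem inner_elem {n d : Fin K → ℕ} (v w : (s : Slot d) → EuclideanSpace ℝ (Fin (n s.1))) :
    inner ℝ (elem n d v) (elem n d w) = ∏ s, inner ℝ (v s) (w s) := by
  simp only [PiLp.inner_apply, elem_apply, RCLike.inner_apply, conj_trivial]
  rw [← sum_prod_slot]
  exact sum_congr rfl fun i _ => by rw [← prod_mul_distrib]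

theorem inner_elem_update {n d : Fin K → ℕ}
    (v w : (s : Slot d) → EuclideanSpace ℝ (Fin (n s.1))) (s : Slot d)
    (x y : EuclideanSpace ℝ (Fin (n s.1))) :
    inner ℝ (elem n d (Function.update v s x)) (elem n d (Function.update w s y)) =
      inner ℝ x y * ∏ s' ∈ univ.erase s, inner ℝ (v s') (w s') := by
  rw [inner_elem, ← mul_prod_erase univ _ (mem_univ s), Function.update_self, Function.update_self]
  congr 1
  exact prod_congr rfl fun s' hs' => by
    rw [Function.update_of_ne (ne_of_mem_erase hs'), Function.update_of_ne (ne_of_mem_erase hs')]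

theorem inner_elem_eq_zero {n d : Fin K → ℕ}
    {v w : (s : Slot d) → EuclideanSpace ℝ (Fin (n s.1))} (s : Slot d)
    (h : inner ℝ (v s) (w s) = 0) : inner ℝ (elem n d v) (elem n d w) = 0 := by
  rw [inner_elem]
  exact prod_eq_zero (mem_univ s) h

/-- The vectors of a partially symmetric elementary tensor. -/
def diagFamily {n : Fin K → ℕ} (d : Fin K → ℕ) (a : (k : Fin K) → EuclideanSpace ℝ (Fin (n k))) :
    (s : Slot d) → EuclideanSpace ℝ (Fin (n s.1)) := fun s => a s.1

theorem rankOneTensor_eq (n d : Fin K → ℕ) (α : ℝ)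
    (a : (k : Fin K) → EuclideanSpace ℝ (Fin (n k))) :
    rankOneTensor n d α a = α • elem n d (diagFamily d a) := by
  ext i
  rw [PiLp.smul_apply, elem_apply, Fintype.prod_sigma]
  rfl

/-- The norms are absorbed into the scalar. Dropping the unit-norm condition lets straight lines in
the parameters serve as curves in the manifold. -/
theorem smul_elem_mem_segreVeronese {n d : Fin K → ℕ} {α : ℝ}
    {a : (k : Fin K) → EuclideanSpace ℝ (Fin (n k))} (hα : α ≠ 0) (ha : ∀ k, a k ≠ 0) :
    α • elem n d (diagFamily d a) ∈ segreVeronese n d := by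
  refine ⟨α * ∏ s : Slot d, ‖a s.1‖, fun k => ‖a k‖⁻¹ • a k,
    mul_ne_zero hα (prod_ne_zero_iff.2 fun s _ => norm_ne_zero_iff.2 (ha _)), fun k => ?_, ?_⟩
  · rw [norm_smul, norm_inv, norm_norm, inv_mul_cancel₀ (norm_ne_zero_iff.2 (ha k))]
  · rw [rankOneTensor_eq, mul_smul, ← (elem n d).map_smul_univ]
    congr 2
    ext1 s
    simp only [diagFamily]
    rw [smul_inv_smul₀ (norm_ne_zero_iff.2 (ha _))]

/-! ### Isometric changes of basis -/

/-- Multiplication of each vector by a matrix. -/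
def mulFamily {m n : Fin K → ℕ} (Q : (k : Fin K) → Matrix (Fin (n k)) (Fin (m k)) ℝ)
    (a : (k : Fin K) → EuclideanSpace ℝ (Fin (m k))) (k : Fin K) :
    EuclideanSpace ℝ (Fin (n k)) :=
  Matrix.toEuclideanLin (Q k) (a k)

theorem Matrix.inner_toEuclideanLin_left {p q : Type*} [Fintype p] [Fintype q]
    [DecidableEq p] [DecidableEq q] (Q : Matrix p q ℝ)
    (x : EuclideanSpace ℝ q) (y : EuclideanSpace ℝ p) :
    inner ℝ (Matrix.toEuclideanLin Q x) y = inner ℝ x (Matrix.toEuclideanLin Qᵀ y) := by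
  rw [← Matrix.conjTranspose_eq_transpose_of_trivial,
    Matrix.toEuclideanLin_conjTranspose_eq_adjoint, LinearMap.adjoint_inner_right]

theorem Matrix.toEuclideanLin_transpose_apply_apply {p q : Type*} [Fintype p] [Fintype q]
    [DecidableEq p] [DecidableEq q] {Q : Matrix p q ℝ}
    (hQ : Qᵀ * Q = 1) (x : EuclideanSpace ℝ q) :
    Matrix.toEuclideanLin Qᵀ (Matrix.toEuclideanLin Q x) = x := by
  ext i
  simp [Matrix.mulVec_mulVec, hQ]

theorem Matrix.inner_toEuclideanLin {p q : Type*} [Fintype p] [Fintype q]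
    [DecidableEq p] [DecidableEq q] {Q : Matrix p q ℝ}
    (hQ : Qᵀ * Q = 1) (x y : EuclideanSpace ℝ q) :
    inner ℝ (Matrix.toEuclideanLin Q x) (Matrix.toEuclideanLin Q y) = inner ℝ x y := by
  rw [Matrix.inner_toEuclideanLin_left, Matrix.toEuclideanLin_transpose_apply_apply hQ]

/-- The Kronecker product matrix of the action `multilinearMul`. -/
def kroneckerMatrix {m n : Fin K → ℕ} (d : Fin K → ℕ)
    (Q : (k : Fin K) → Matrix (Fin (n k)) (Fin (m k)) ℝ) :
    Matrix ((k : Fin K) → Fin (d k) → Fin (n k)) ((k : Fin K) → Fin (d k) → Fin (m k)) ℝ :=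
  Matrix.of fun i j => ∏ s : Slot d, Q s.1 (i s.1 s.2) (j s.1 s.2)

theorem multilinearMul_eq {m n : Fin K → ℕ} (d : Fin K → ℕ)
    (Q : (k : Fin K) → Matrix (Fin (n k)) (Fin (m k)) ℝ) (X : MixedTensor m d) :
    multilinearMul d Q X = Matrix.toEuclideanLin (kroneckerMatrix d Q) X := by
  ext i
  simp [multilinearMul, kroneckerMatrix, Matrix.mulVec, dotProduct, Fintype.prod_sigma]

theorem kroneckerMatrix_transpose_mul_self {m n d : Fin K → ℕ}
    {Q : (k : Fin K) → Matrix (Fin (n k)) (Fin (m k)) ℝ} (hQ : ∀ k, (Q k)ᵀ * Q k = 1) :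
    (kroneckerMatrix d Q)ᵀ * kroneckerMatrix d Q = 1 := by
  ext j j'
  have h : ∀ s : Slot d, ∑ i, Q s.1 i (j s.1 s.2) * Q s.1 i (j' s.1 s.2) =
      if j s.1 s.2 = j' s.1 s.2 then 1 else 0 := fun s => by
    have := congrFun (congrFun (hQ s.1) (j s.1 s.2)) (j' s.1 s.2)
    rwa [Matrix.mul_apply, Matrix.one_apply] at this
  rw [Matrix.mul_apply, Matrix.one_apply]
  simp only [kroneckerMatrix, Matrix.transpose_apply, Matrix.of_apply, ← prod_mul_distrib]
  rw [sum_prod_slot fun s i => Q s.1 i (j s.1 s.2) * Q s.1 i (j' s.1 s.2)]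
  simp only [h]
  split_ifs with hj
  · simp [hj]
  · obtain ⟨k, hk⟩ := Function.ne_iff.1 hj
    obtain ⟨t, ht⟩ := Function.ne_iff.1 hk
    exact prod_eq_zero (mem_univ (⟨k, t⟩ : Slot d)) (if_neg ht)

theorem norm_multilinearMul {m n d : Fin K → ℕ}
    {Q : (k : Fin K) → Matrix (Fin (n k)) (Fin (m k)) ℝ} (hQ : ∀ k, (Q k)ᵀ * Q k = 1)
    (X : MixedTensor m d) : ‖multilinearMul d Q X‖ = ‖X‖ := by
  have h : inner ℝ (multilinearMul d Q X) (multilinearMul d Q X) = inner ℝ X X := by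
    rw [multilinearMul_eq, Matrix.inner_toEuclideanLin (kroneckerMatrix_transpose_mul_self hQ)]
  rw [real_inner_self_eq_norm_sq, real_inner_self_eq_norm_sq] at h
  exact (sq_eq_sq₀ (norm_nonneg _) (norm_nonneg _)).1 h

theorem multilinearMul_elem {m n d : Fin K → ℕ}
    (Q : (k : Fin K) → Matrix (Fin (n k)) (Fin (m k)) ℝ)
    (v : (s : Slot d) → EuclideanSpace ℝ (Fin (m s.1))) :
    multilinearMul d Q (elem m d v) = elem n d fun s => Matrix.toEuclideanLin (Q s.1) (v s) := by
  ext i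
  rw [multilinearMul_eq, Matrix.toLpLin_apply, elem_apply]
  simp only [Matrix.mulVec, dotProduct, kroneckerMatrix, Matrix.of_apply, elem_apply,
    ← prod_mul_distrib, Matrix.toLpLin_apply]
  exact sum_prod_slot fun s j => Q s.1 (i s.1 s.2) j * v s j

theorem multilinearMul_rankOne {m n d : Fin K → ℕ}
    (Q : (k : Fin K) → Matrix (Fin (n k)) (Fin (m k)) ℝ) (α : ℝ)
    (a : (k : Fin K) → EuclideanSpace ℝ (Fin (m k))) :
    multilinearMul d Q (α • elem m d (diagFamily d a)) = α • elem n d (diagFamily d (mulFamily Q a)) := by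
  rw [multilinearMul_eq, map_smul, ← multilinearMul_eq, multilinearMul_elem]
  rfl

/-! ### Tangent vectors -/

/-- The derivative of `(α, a) ↦ α a₁^{⊗ d₁} ⊗ ⋯ ⊗ a_K^{⊗ d_K}` in the direction `p`. -/
def tangentVec {n : Fin K → ℕ} (d : Fin K → ℕ) (α : ℝ)
    (a : (k : Fin K) → EuclideanSpace ℝ (Fin (n k)))
    (p : ℝ × ((k : Fin K) → EuclideanSpace ℝ (Fin (n k)))) : MixedTensor n d :=
  p.1 • elem n d (diagFamily d a) + α • ∑ s, elem n d (Function.update (diagFamily d a) s (p.2 s.1))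

theorem multilinearMul_tangentVec {m n d : Fin K → ℕ}
    (Q : (k : Fin K) → Matrix (Fin (n k)) (Fin (m k)) ℝ) (α : ℝ)
    (a : (k : Fin K) → EuclideanSpace ℝ (Fin (m k)))
    (p : ℝ × ((k : Fin K) → EuclideanSpace ℝ (Fin (m k)))) :
    multilinearMul d Q (tangentVec d α a p) =
      tangentVec d α (mulFamily Q a) (p.1, mulFamily Q p.2) := by
  simp only [tangentVec]
  rw [multilinearMul_eq, map_add, map_smul, map_smul, map_sum]
  simp only [← multilinearMul_eq, multilinearMul_elem]
  congr 3
  ext1 s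
  congr 1
  ext1 s'
  by_cases h : s' = s
  · subst h
    simp [mulFamily]
  · rw [Function.update_of_ne h, Function.update_of_ne h]
    rfl

variable {R : ℕ}

/-- The addition map is bounded below by `√c` on the product of the tangent spaces to the
Segre-Veronese manifold at the points `α r • elem n d (diagFamily d (a r))`. -/
def TerraciniBound {n : Fin K → ℕ} (d : Fin K → ℕ) (α : Fin R → ℝ)
    (a : Fin R → (k : Fin K) → EuclideanSpace ℝ (Fin (n k))) (c : ℝ) : Prop :=
  ∀ p : Fin R → ℝ × ((k : Fin K) → EuclideanSpace ℝ (Fin (n k))),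
    c * ∑ r, ‖tangentVec d (α r) (a r) (p r)‖ ^ 2 ≤ ‖∑ r, tangentVec d (α r) (a r) (p r)‖ ^ 2

/-- The Gram matrix of the tensors obtained by deleting the slot `s` is bounded below by `c`. -/
def GramBound {n : Fin K → ℕ} {d : Fin K → ℕ}
    (a : Fin R → (k : Fin K) → EuclideanSpace ℝ (Fin (n k))) (s : Slot d) (c : ℝ) : Prop :=
  ∀ y : Fin R → ℝ, c * ∑ r, y r ^ 2 ≤
    ∑ r, ∑ r', y r * y r' * ∏ s' ∈ univ.erase s, inner ℝ (a r s'.1) (a r' s'.1)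

end Elementary
end

noncomputable section

/-! ### Comparison of bounds under isometric changes of basis -/

section Comparison

variable {K R : ℕ}

open Finset

theorem norm_sum_sq_of_orthogonal {ι V : Type*} [Fintype ι] [NormedAddCommGroup V]
    [InnerProductSpace ℝ V] {y : ι → V} (h : ∀ i j, i ≠ j → inner ℝ (y i) (y j) = 0) :
    ‖∑ i, y i‖ ^ 2 = ∑ i, ‖y i‖ ^ 2 := by
  classical
  rw [← real_inner_self_eq_norm_sq, sum_inner]
  refine sum_congr rfl fun i _ => ?_
  rw [inner_sum, sum_eq_single i (fun j _ hj => h i j hj.symm) (by simp),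
    real_inner_self_eq_norm_sq]

theorem norm_add_sum_sq_of_orthogonal {ι V : Type*} [Fintype ι] [NormedAddCommGroup V]
    [InnerProductSpace ℝ V] {x : V} {y : ι → V} (hx : ∀ i, inner ℝ x (y i) = 0)
    (h : ∀ i j, i ≠ j → inner ℝ (y i) (y j) = 0) :
    ‖x + ∑ i, y i‖ ^ 2 = ‖x‖ ^ 2 + ∑ i, ‖y i‖ ^ 2 := by
  rw [norm_add_sq_real, inner_sum, sum_eq_zero fun i _ => hx i, norm_sum_sq_of_orthogonal h]
  ring

theorem norm_sum_smul_elem_update_sq {n d : Fin K → ℕ}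
    (a : Fin R → (k : Fin K) → EuclideanSpace ℝ (Fin (n k))) (s : Slot d) (c : Fin R → ℝ)
    (w : Fin R → EuclideanSpace ℝ (Fin (n s.1))) :
    ‖∑ r, c r • elem n d (Function.update (diagFamily d (a r)) s (w r))‖ ^ 2 =
      ∑ r, ∑ r', c r * c r' * inner ℝ (w r) (w r') *
        ∏ s' ∈ univ.erase s, inner ℝ (a r s'.1) (a r' s'.1) := by
  rw [← real_inner_self_eq_norm_sq, sum_inner]
  refine sum_congr rfl fun r _ => ?_
  rw [inner_sum]
  refine sum_congr rfl fun r' _ => ?_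
  rw [real_inner_smul_left, real_inner_smul_right, inner_elem_update]
  simp only [diagFamily]
  ring

/-- The Gram matrix for a slot `s` depends only on the factor that `s` belongs to. -/
theorem prod_erase_slot_eq {d : Fin K → ℕ} (f : Fin K → ℝ) {s t : Slot d} (h : s.1 = t.1) :
    ∏ s' ∈ univ.erase s, f s'.1 = ∏ s' ∈ univ.erase t, f s'.1 := by
  refine prod_equiv (Equiv.swap s t) (fun i => ?_) fun i hi => ?_
  · simp only [mem_erase, mem_univ, and_true, ne_eq]
    rw [Equiv.swap_apply_eq_iff, Equiv.swap_apply_right]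
  · congr 1
    rcases eq_or_ne i t with rfl | ht
    · rw [Equiv.swap_apply_right, h]
    · rw [Equiv.swap_apply_of_ne_of_ne (ne_of_mem_erase hi) ht]

/-! ### Behaviour of the tangent and Gram bounds under isometries -/

theorem GramBound.mono {n d : Fin K → ℕ}
    {a : Fin R → (k : Fin K) → EuclideanSpace ℝ (Fin (n k))} {s : Slot d} {c c' : ℝ}
    (h : GramBound a s c) (hc : c' ≤ c) : GramBound a s c' := fun y =>
  (mul_le_mul_of_nonneg_right hc (sum_nonneg fun _ _ => sq_nonneg _)).trans (h y)

theorem TerraciniBound.mono {n d : Fin K → ℕ} {α : Fin R → ℝ}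
    {a : Fin R → (k : Fin K) → EuclideanSpace ℝ (Fin (n k))} {c c' : ℝ}
    (h : TerraciniBound d α a c) (hc : c' ≤ c) : TerraciniBound d α a c' := fun p =>
  (mul_le_mul_of_nonneg_right hc (sum_nonneg fun _ _ => sq_nonneg _)).trans (h p)

/-- The isometry carries tangent vectors to tangent vectors. An arbitrary index set `F` covers both
the full sum and single summands. -/
theorem norm_sum_tangentVec_mulFamily {m n d : Fin K → ℕ}
    {Q : (k : Fin K) → Matrix (Fin (n k)) (Fin (m k)) ℝ} (hQ : ∀ k, (Q k)ᵀ * Q k = 1)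
    (F : Finset (Fin R)) (α : Fin R → ℝ) (a : Fin R → (k : Fin K) → EuclideanSpace ℝ (Fin (m k)))
    (p : Fin R → ℝ × ((k : Fin K) → EuclideanSpace ℝ (Fin (m k)))) :
    ‖∑ r ∈ F, tangentVec d (α r) (mulFamily Q (a r)) ((p r).1, mulFamily Q (p r).2)‖ =
      ‖∑ r ∈ F, tangentVec d (α r) (a r) (p r)‖ := by
  simp only [← multilinearMul_tangentVec, multilinearMul_eq, ← map_sum]
  rw [← multilinearMul_eq, norm_multilinearMul hQ]

theorem TerraciniBound.of_map {m n d : Fin K → ℕ} {α : Fin R → ℝ}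
    {a : Fin R → (k : Fin K) → EuclideanSpace ℝ (Fin (m k))}
    {Q : (k : Fin K) → Matrix (Fin (n k)) (Fin (m k)) ℝ} (hQ : ∀ k, (Q k)ᵀ * Q k = 1) {c : ℝ}
    (h : TerraciniBound d α (fun r => mulFamily Q (a r)) c) : TerraciniBound d α a c := fun p => by
  have h1 := h fun r => ((p r).1, mulFamily Q (p r).2)
  rw [norm_sum_tangentVec_mulFamily hQ univ] at h1
  refine le_trans (le_of_eq ?_) h1
  congr 1
  refine sum_congr rfl fun r _ => ?_
  have h2 := norm_sum_tangentVec_mulFamily (d := d) hQ {r} α a p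
  rw [sum_singleton, sum_singleton] at h2
  rw [h2]

theorem inner_mulFamily {m n : Fin K → ℕ}
    {Q : (k : Fin K) → Matrix (Fin (n k)) (Fin (m k)) ℝ} (hQ : ∀ k, (Q k)ᵀ * Q k = 1)
    (x y : (k : Fin K) → EuclideanSpace ℝ (Fin (m k))) (k : Fin K) :
    inner ℝ (mulFamily Q x k) (mulFamily Q y k) = inner ℝ (x k) (y k) :=
  Matrix.inner_toEuclideanLin (hQ k) _ _

theorem inner_mulFamily_eq_zero {m n : Fin K → ℕ}
    {Q : (k : Fin K) → Matrix (Fin (n k)) (Fin (m k)) ℝ}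
    (x : (k : Fin K) → EuclideanSpace ℝ (Fin (m k))) {k : Fin K}
    {w : EuclideanSpace ℝ (Fin (n k))} (hw : Matrix.toEuclideanLin (Q k)ᵀ w = 0) :
    inner ℝ (mulFamily Q x k) w = 0 := by
  rw [mulFamily, Matrix.inner_toEuclideanLin_left, hw, inner_zero_right]

theorem GramBound.map {m n d : Fin K → ℕ}
    {a : Fin R → (k : Fin K) → EuclideanSpace ℝ (Fin (m k))}
    {Q : (k : Fin K) → Matrix (Fin (n k)) (Fin (m k)) ℝ} (hQ : ∀ k, (Q k)ᵀ * Q k = 1)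
    {s : Slot d} {c : ℝ} (h : GramBound a s c) :
    GramBound (fun r => mulFamily Q (a r)) s c := fun y => by
  simp only [inner_mulFamily hQ]
  exact h y

theorem GramBound.of_map {m n d : Fin K → ℕ}
    {a : Fin R → (k : Fin K) → EuclideanSpace ℝ (Fin (m k))}
    {Q : (k : Fin K) → Matrix (Fin (n k)) (Fin (m k)) ℝ} (hQ : ∀ k, (Q k)ᵀ * Q k = 1)
    {s : Slot d} {c : ℝ} (h : GramBound (fun r => mulFamily Q (a r)) s c) :
    GramBound a s c := fun y => by
  have h1 := h y
  simp only [inner_mulFamily hQ] at h1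
  exact h1

/-- The Gram bound extends to vector-valued coefficients. -/
theorem GramBound.norm_sum_ge {n d : Fin K → ℕ}
    {a : Fin R → (k : Fin K) → EuclideanSpace ℝ (Fin (n k))} {s : Slot d} {c : ℝ}
    (h : GramBound a s c) (α : Fin R → ℝ) (w : Fin R → EuclideanSpace ℝ (Fin (n s.1))) :
    c * ∑ r, α r ^ 2 * ‖w r‖ ^ 2 ≤
      ‖∑ r, α r • elem n d (Function.update (diagFamily d (a r)) s (w r))‖ ^ 2 := by
  -- The scalar bound is applied to each coordinate of the vectors `α r • w r`, and the results are
  -- added.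
  have h1 := sum_le_sum fun i (_ : i ∈ univ) => h fun r => α r * w r i
  rw [norm_sum_smul_elem_update_sq]
  refine Eq.trans_le ?_ (h1.trans_eq ?_)
  · rw [← mul_sum, sum_comm]
    congr 1
    refine sum_congr rfl fun r _ => ?_
    rw [EuclideanSpace.real_norm_sq_eq, mul_sum]
    exact sum_congr rfl fun i _ => (mul_pow _ _ _).symm
  · rw [sum_comm]
    refine sum_congr rfl fun r _ => ?_
    rw [sum_comm]
    refine sum_congr rfl fun r' _ => ?_
    rw [PiLp.inner_apply, mul_sum, sum_mul]
    refine sum_congr rfl fun i _ => ?_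
    simp only [RCLike.inner_apply, conj_trivial]
    ring

theorem norm_elem_update_sq {n d : Fin K → ℕ} {a : (k : Fin K) → EuclideanSpace ℝ (Fin (n k))}
    (ha : ∀ k, ‖a k‖ = 1) (s : Slot d) (w : EuclideanSpace ℝ (Fin (n s.1))) :
    ‖elem n d (Function.update (diagFamily d a) s w)‖ ^ 2 = ‖w‖ ^ 2 := by
  rw [← real_inner_self_eq_norm_sq, inner_elem_update, real_inner_self_eq_norm_sq,
    prod_eq_one fun s' _ => ?_, mul_one]
  rw [diagFamily, real_inner_self_eq_norm_sq, ha, one_pow]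

/-- The tangent vector in the direction `Q c + w` splits orthogonally into the
image of a tangent vector and the components of `w` in the different slots. -/
theorem norm_sum_tangentVec_add_sq {m n d : Fin K → ℕ}
    {Q : (k : Fin K) → Matrix (Fin (n k)) (Fin (m k)) ℝ} (hQ : ∀ k, (Q k)ᵀ * Q k = 1)
    (F : Finset (Fin R)) (α : Fin R → ℝ) (a : Fin R → (k : Fin K) → EuclideanSpace ℝ (Fin (m k)))
    (p : Fin R → ℝ × ((k : Fin K) → EuclideanSpace ℝ (Fin (m k))))
    (w : Fin R → (k : Fin K) → EuclideanSpace ℝ (Fin (n k)))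
    (hw : ∀ r k, Matrix.toEuclideanLin (Q k)ᵀ (w r k) = 0) :
    ‖∑ r ∈ F, tangentVec d (α r) (mulFamily Q (a r)) ((p r).1, mulFamily Q (p r).2 + w r)‖ ^ 2 =
      ‖∑ r ∈ F, tangentVec d (α r) (a r) (p r)‖ ^ 2 +
        ∑ s : Slot d, ‖∑ r ∈ F, α r • elem n d
          (Function.update (diagFamily d (mulFamily Q (a r))) s (w r s.1))‖ ^ 2 := by
  have hsplit : ∀ r,
      tangentVec d (α r) (mulFamily Q (a r)) ((p r).1, mulFamily Q (p r).2 + w r) =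
        tangentVec d (α r) (mulFamily Q (a r)) ((p r).1, mulFamily Q (p r).2) +
          ∑ s : Slot d, α r • elem n d
            (Function.update (diagFamily d (mulFamily Q (a r))) s (w r s.1)) := fun r => by
    simp only [tangentVec, Pi.add_apply, ContinuousMultilinearMap.map_update_add, sum_add_distrib,
      smul_add, smul_sum, add_assoc]
  -- In slot `s'` one tensor has a vector of the range of `Q`, the other a vector of the kernel of
  -- `Qᵀ`; a single vanishing factor kills the inner product.
  have horth : ∀ r (s : Slot d) r' (s' : Slot d), s ≠ s' → inner ℝ
      (elem n d (Function.update (diagFamily d (mulFamily Q (a r))) s (w r s.1)))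
      (elem n d (Function.update (diagFamily d (mulFamily Q (a r'))) s' (w r' s'.1))) = 0 := by
    intro r s r' s' hs
    refine inner_elem_eq_zero s' ?_
    rw [Function.update_self, Function.update_of_ne hs.symm]
    exact inner_mulFamily_eq_zero _ (hw r' s'.1)
  have horth' : ∀ r r' (s : Slot d),
      inner ℝ (tangentVec d (α r) (mulFamily Q (a r)) ((p r).1, mulFamily Q (p r).2))
        (elem n d (Function.update (diagFamily d (mulFamily Q (a r'))) s (w r' s.1))) = 0 := by
    intro r r' s
    rw [tangentVec, inner_add_left, real_inner_smul_left, real_inner_smul_left, sum_inner,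
      inner_elem_eq_zero s, sum_eq_zero]
    · simp
    · intro s' _
      refine inner_elem_eq_zero s ?_
      rw [Function.update_self]
      by_cases hs : s = s'
      · subst hs
        rw [Function.update_self]
        exact inner_mulFamily_eq_zero _ (hw r' _)
      · rw [Function.update_of_ne hs]
        exact inner_mulFamily_eq_zero _ (hw r' _)
    · rw [Function.update_self]
      exact inner_mulFamily_eq_zero _ (hw r' _)
  simp only [hsplit, sum_add_distrib]
  rw [sum_comm, norm_add_sum_sq_of_orthogonal, norm_sum_tangentVec_mulFamily hQ]
  · intro s
    rw [sum_inner]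
    refine sum_eq_zero fun r _ => ?_
    rw [inner_sum]
    refine sum_eq_zero fun r' _ => ?_
    rw [real_inner_smul_right, horth', mul_zero]
  · intro s s' hs
    rw [sum_inner]
    refine sum_eq_zero fun r _ => ?_
    rw [inner_sum]
    refine sum_eq_zero fun r' _ => ?_
    rw [real_inner_smul_right, real_inner_smul_left, horth r s r' s' hs, mul_zero, mul_zero]

/-- Both sides of the inequality split along the same orthogonal decomposition: `h` bounds the part
coming from `G`, and `hg` bounds the part of each slot. -/
theorem TerraciniBound.map {m n d : Fin K → ℕ} {α : Fin R → ℝ}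
    {a : Fin R → (k : Fin K) → EuclideanSpace ℝ (Fin (m k))} (ha : ∀ r k, ‖a r k‖ = 1)
    {Q : (k : Fin K) → Matrix (Fin (n k)) (Fin (m k)) ℝ} (hQ : ∀ k, (Q k)ᵀ * Q k = 1) {c : ℝ}
    (h : TerraciniBound d α a c) (hg : ∀ s : Slot d, GramBound a s c) :
    TerraciniBound d α (fun r => mulFamily Q (a r)) c := by
  have hQa : ∀ r k, ‖mulFamily Q (a r) k‖ = 1 := fun r k => by
    rw [norm_eq_sqrt_real_inner, inner_mulFamily hQ, ← norm_eq_sqrt_real_inner, ha]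
  intro q
  obtain ⟨p, w, hw, rfl⟩ : ∃ (p : Fin R → ℝ × ((k : Fin K) → EuclideanSpace ℝ (Fin (m k))))
      (w : Fin R → (k : Fin K) → EuclideanSpace ℝ (Fin (n k))),
      (∀ r k, Matrix.toEuclideanLin (Q k)ᵀ (w r k) = 0) ∧
        q = fun r => ((p r).1, mulFamily Q (p r).2 + w r) := by
    -- Orthogonal projection onto the range of `Q k`, which is `Q k * (Q k)ᵀ`, and the remainder.
    refine ⟨fun r => ((q r).1, fun k => Matrix.toEuclideanLin (Q k)ᵀ ((q r).2 k)),
      fun r k => (q r).2 k -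
        Matrix.toEuclideanLin (Q k) (Matrix.toEuclideanLin (Q k)ᵀ ((q r).2 k)),
      fun r k => ?_, ?_⟩
    · rw [map_sub, Matrix.toEuclideanLin_transpose_apply_apply (hQ k), sub_self]
    · ext1 r
      refine Prod.ext rfl (funext fun k => ?_)
      simp only [Pi.add_apply, mulFamily, add_sub_cancel]
  rw [norm_sum_tangentVec_add_sq hQ univ α a p w hw]
  have h1 : ∀ r, ‖tangentVec d (α r) (mulFamily Q (a r))
      ((p r).1, mulFamily Q (p r).2 + w r)‖ ^ 2 =
      ‖tangentVec d (α r) (a r) (p r)‖ ^ 2 + ∑ s : Slot d, α r ^ 2 * ‖w r s.1‖ ^ 2 := fun r => by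
    have := norm_sum_tangentVec_add_sq (d := d) hQ {r} α a p w hw
    simp only [sum_singleton] at this
    rw [this]
    congr 1
    refine sum_congr rfl fun s _ => ?_
    rw [norm_smul, mul_pow, Real.norm_eq_abs, sq_abs, norm_elem_update_sq (hQa r)]
  simp only [h1, sum_add_distrib, mul_add]
  refine add_le_add (h p) ?_
  rw [sum_comm, mul_sum]
  exact sum_le_sum fun s _ => ((hg s).map hQ).norm_sum_ge α fun r => w r s.1

/-! ### Gram bounds extracted from tangent bounds -/

/-- The tangent vector whose direction is `x • u` in the `k`-th factor. -/
theorem tangentVec_single {n : Fin K → ℕ} (d : Fin K → ℕ) (α x : ℝ)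
    (a : (k : Fin K) → EuclideanSpace ℝ (Fin (n k))) (k : Fin K)
    (u : EuclideanSpace ℝ (Fin (n k))) :
    tangentVec d α a (0, Pi.single k (x • u)) =
      ∑ t, (α * x) • elem n d (Function.update (diagFamily d a) ⟨k, t⟩ u) := by
  rw [tangentVec, zero_smul, zero_add, Fintype.sum_sigma, sum_eq_single k, smul_sum]
  · refine sum_congr rfl fun t _ => ?_
    rw [mul_smul, ← ContinuousMultilinearMap.map_update_smul]
    simp
  · intro k' _ hk'
    refine sum_eq_zero fun t _ => (elem n d).map_coord_zero ⟨k', t⟩ ?_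
    rw [Function.update_self]
    exact Pi.single_eq_of_ne hk' _
  · simp

/-- Each of the `d k` terms has norm one, and two different terms have inner product `⟪a k, u⟫² ≥
0`, so the cross terms can only help. -/
theorem norm_sum_elem_update_sq_ge {n d : Fin K → ℕ}
    {a : (k : Fin K) → EuclideanSpace ℝ (Fin (n k))} (ha : ∀ k, ‖a k‖ = 1) (k : Fin K)
    {u : EuclideanSpace ℝ (Fin (n k))} (hu : ‖u‖ = 1) :
    (d k : ℝ) ≤ ‖∑ t, elem n d (Function.update (diagFamily d a) ⟨k, t⟩ u)‖ ^ 2 := by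
  rw [← real_inner_self_eq_norm_sq, sum_inner]
  have h1 : ∀ t : Fin (d k), 1 ≤ inner ℝ
      (elem n d (Function.update (diagFamily d a) ⟨k, t⟩ u))
      (∑ t', elem n d (Function.update (diagFamily d a) ⟨k, t'⟩ u)) := by
    intro t
    rw [inner_sum, ← add_sum_erase univ _ (mem_univ t), real_inner_self_eq_norm_sq,
      norm_elem_update_sq ha, hu, one_pow]
    refine le_add_of_nonneg_right (sum_nonneg fun t' ht' => ?_)
    have hne : (⟨k, t⟩ : Slot d) ≠ ⟨k, t'⟩ := fun h => by
      cases h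
      exact ne_of_mem_erase ht' rfl
    rw [inner_elem, Fintype.prod_eq_mul (⟨k, t⟩ : Slot d) ⟨k, t'⟩ hne]
    · rw [Function.update_self, Function.update_self, Function.update_of_ne hne,
        Function.update_of_ne hne.symm]
      simp only [diagFamily]
      rw [real_inner_comm]
      exact mul_self_nonneg _
    · rintro s ⟨h1, h2⟩
      rw [Function.update_of_ne h1, Function.update_of_ne h2, diagFamily,
        real_inner_self_eq_norm_sq, ha, one_pow]
  calc (d k : ℝ) = ∑ _t : Fin (d k), (1 : ℝ) := by simp
    _ ≤ _ := sum_le_sum fun t _ => h1 t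

theorem sum_mul_norm_sq_le_of_single {n d : Fin K → ℕ} (α : Fin R → ℝ)
    {a : Fin R → (k : Fin K) → EuclideanSpace ℝ (Fin (n k))} (ha : ∀ r k, ‖a r k‖ = 1)
    (x : Fin R → ℝ) (k : Fin K) {u : EuclideanSpace ℝ (Fin (n k))} (hu : ‖u‖ = 1) :
    d k * ∑ r, (α r * x r) ^ 2 ≤
      ∑ r, ‖tangentVec d (α r) (a r) (0, Pi.single k (x r • u))‖ ^ 2 := by
  rw [mul_sum]
  refine sum_le_sum fun r _ => ?_
  rw [tangentVec_single, ← smul_sum, norm_smul, mul_pow ‖_‖, Real.norm_eq_abs, sq_abs, mul_comm]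
  exact mul_le_mul_of_nonneg_left (norm_sum_elem_update_sq_ge (ha r) k hu) (sq_nonneg _)

theorem norm_sum_elem_update_const_sq {n d : Fin K → ℕ}
    (a : Fin R → (k : Fin K) → EuclideanSpace ℝ (Fin (n k))) (y : Fin R → ℝ) (s : Slot d)
    (t : Fin (d s.1)) {u : EuclideanSpace ℝ (Fin (n s.1))} (hu : ‖u‖ = 1) :
    ‖∑ r, y r • elem n d (Function.update (diagFamily d (a r)) ⟨s.1, t⟩ u)‖ ^ 2 =
      ∑ r, ∑ r', y r * y r' * ∏ s' ∈ univ.erase s, inner ℝ (a r s'.1) (a r' s'.1) := by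
  have h := norm_sum_smul_elem_update_sq a (⟨s.1, t⟩ : Slot d) y fun _ => u
  rw [h]
  refine sum_congr rfl fun r _ => sum_congr rfl fun r' _ => ?_
  rw [real_inner_self_eq_norm_sq, hu, one_pow, mul_one,
    prod_erase_slot_eq (fun k => inner ℝ (a r k) (a r' k)) (s := (⟨s.1, t⟩ : Slot d)) (t := s) rfl]

/-- The test directions are multiples of one unit vector `u`. The summands then have total squared
norm at least `d k * ∑ y r ^ 2`, while Cauchy–Schwarz over the slots bounds the squared norm of
their sum by `d k ^ 2` times the Gram form. -/
theorem TerraciniBound.gramBound {n d : Fin K → ℕ} {α : Fin R → ℝ} (hα : ∀ r, α r ≠ 0)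
    {a : Fin R → (k : Fin K) → EuclideanSpace ℝ (Fin (n k))} (ha : ∀ r k, ‖a r k‖ = 1)
    {c : ℝ} (hc : 0 ≤ c) (h : TerraciniBound d α a c) (s : Slot d) :
    GramBound a s (c / d s.1) := by
  intro y
  rcases Nat.eq_zero_or_pos R with rfl | hR
  · simp
  have hd : (0 : ℝ) < d s.1 := Nat.cast_pos.2 (Fin.pos s.2)
  -- Any unit vector would do, as directions in `tangentVec` need not be orthogonal to `a r`; `R >
  -- 0` guarantees that one exists.
  have hu := ha ⟨0, hR⟩ s.1
  set u := a ⟨0, hR⟩ s.1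
  have h1 := h fun r => (0, Pi.single s.1 ((y r / α r) • u))
  have h2 := sum_mul_norm_sq_le_of_single (d := d) α ha (fun r => y r / α r) s.1 hu
  have h3 : ∀ r, α r * (y r / α r) = y r := fun r => mul_div_cancel₀ _ (hα r)
  simp only [h3] at h2
  have h4 : ‖∑ r, tangentVec d (α r) (a r) (0, Pi.single s.1 ((y r / α r) • u))‖ ^ 2 ≤
      d s.1 * ∑ t, ‖∑ r, y r • elem n d (Function.update (diagFamily d (a r)) ⟨s.1, t⟩ u)‖ ^ 2 := by
    simp only [tangentVec_single, h3]
    rw [sum_comm]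
    have h5 := sq_sum_le_card_mul_sum_sq (s := univ) (f := fun t =>
      ‖∑ r, y r • elem n d (Function.update (diagFamily d (a r)) ⟨s.1, t⟩ u)‖)
    rw [card_univ, Fintype.card_fin] at h5
    exact (pow_le_pow_left₀ (norm_nonneg _) (norm_sum_le _ _) 2).trans h5
  simp only [norm_sum_elem_update_const_sq a y s _ hu, sum_const, card_univ, Fintype.card_fin,
    nsmul_eq_mul] at h4
  set G := ∑ r, ∑ r', y r * y r' * ∏ s' ∈ univ.erase s, inner ℝ (a r s'.1) (a r' s'.1)
  have h6 : c * (d s.1 * ∑ r, y r ^ 2) ≤ d s.1 * (d s.1 * G) :=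
    (mul_le_mul_of_nonneg_left h2 hc).trans (h1.trans h4)
  rw [mul_left_comm] at h6
  have h7 := le_of_mul_le_mul_left h6 hd
  rw [div_mul_eq_mul_div, div_le_iff₀ hd]
  linarith

theorem exists_norm_eq_one_of_lt {p q : ℕ} (Q : Matrix (Fin p) (Fin q) ℝ) (h : q < p) :
    ∃ w, ‖w‖ = 1 ∧ Matrix.toEuclideanLin Qᵀ w = 0 := by
  have h1 : LinearMap.ker (Matrix.toEuclideanLin Qᵀ) ≠ ⊥ :=
    LinearMap.ker_ne_bot_of_finrank_lt (by simpa using h)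
  obtain ⟨w, hw, hw0⟩ := (Submodule.ne_bot_iff _).1 h1
  refine ⟨‖w‖⁻¹ • w, ?_, ?_⟩
  · rw [norm_smul, norm_inv, norm_norm, inv_mul_cancel₀ (norm_ne_zero_iff.2 hw0)]
  · rw [map_smul, LinearMap.mem_ker.1 hw, smul_zero]

/-- The same test with a unit vector `w` orthogonal to the range of `U`: terms for different slots
are orthogonal, so Pythagoras replaces Cauchy–Schwarz and saves the factor `d k`. -/
theorem TerraciniBound.gramBound_of_lt {m l d : Fin K → ℕ} {α : Fin R → ℝ} (hα : ∀ r, α r ≠ 0)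
    {a : Fin R → (k : Fin K) → EuclideanSpace ℝ (Fin (m k))} (ha : ∀ r k, ‖a r k‖ = 1)
    {U : (k : Fin K) → Matrix (Fin (l k)) (Fin (m k)) ℝ} (hU : ∀ k, (U k)ᵀ * U k = 1)
    {c : ℝ} (hc : 0 ≤ c) (h : TerraciniBound d α (fun r => mulFamily U (a r)) c)
    (s : Slot d) (hlt : m s.1 < l s.1) : GramBound a s c := by
  refine GramBound.of_map hU fun y => ?_
  have hUa : ∀ r k, ‖mulFamily U (a r) k‖ = 1 := fun r k => by
    rw [norm_eq_sqrt_real_inner, inner_mulFamily hU, ← norm_eq_sqrt_real_inner, ha]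
  obtain ⟨w, hw, hUw⟩ := exists_norm_eq_one_of_lt (U s.1) hlt
  have hd : (0 : ℝ) < d s.1 := Nat.cast_pos.2 (Fin.pos s.2)
  have h1 := h fun r => (0, Pi.single s.1 ((y r / α r) • w))
  have h2 := sum_mul_norm_sq_le_of_single (d := d) α hUa (fun r => y r / α r) s.1 hw
  have h3 : ∀ r, α r * (y r / α r) = y r := fun r => mul_div_cancel₀ _ (hα r)
  simp only [h3] at h2
  simp only [tangentVec_single, h3] at h1 h2
  rw [sum_comm, norm_sum_sq_of_orthogonal] at h1
  · simp only [norm_sum_elem_update_const_sq _ y s _ hw, sum_const, card_univ, Fintype.card_fin,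
      nsmul_eq_mul] at h1
    have h6 := (mul_le_mul_of_nonneg_left h2 hc).trans h1
    rw [mul_left_comm] at h6
    exact le_of_mul_le_mul_left h6 hd
  · intro t t' ht
    rw [sum_inner]
    refine sum_eq_zero fun r _ => ?_
    rw [inner_sum]
    refine sum_eq_zero fun r' _ => ?_
    have hne : (⟨s.1, t'⟩ : Slot d) ≠ ⟨s.1, t⟩ := fun h => by
      cases h
      exact ht rfl
    rw [real_inner_smul_right, real_inner_smul_left, inner_elem_eq_zero ⟨s.1, t'⟩, mul_zero,
      mul_zero]
    rw [Function.update_self, Function.update_of_ne hne]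
    exact inner_mulFamily_eq_zero _ hUw

end Comparison
end

noncomputable section

/-! ### The condition number and the differential of the addition map -/

section Terracini

variable {K R : ℕ}

open Finset

/-- Contraction of a tensor with `a` in all slots but `s`. -/
def contractExcept {n d : Fin K → ℕ} (a : (k : Fin K) → EuclideanSpace ℝ (Fin (n k)))
    (s : Slot d) : MixedTensor n d →L[ℝ] EuclideanSpace ℝ (Fin (n s.1)) :=
  ∑ i, (innerSL ℝ (elem n d (Function.update (diagFamily d a) s
    (EuclideanSpace.basisFun _ ℝ i)))).smulRight (EuclideanSpace.basisFun _ ℝ i)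

theorem contractExcept_elem {n d : Fin K → ℕ} (a : (k : Fin K) → EuclideanSpace ℝ (Fin (n k)))
    (s : Slot d) (v : (s : Slot d) → EuclideanSpace ℝ (Fin (n s.1))) :
    contractExcept a s (elem n d v) = (∏ s' ∈ univ.erase s, inner ℝ (a s'.1) (v s')) • v s := by
  have h : ∀ i, inner ℝ (elem n d (Function.update (diagFamily d a) s
      (EuclideanSpace.basisFun _ ℝ i))) (elem n d v) =
      (∏ s' ∈ univ.erase s, inner ℝ (a s'.1) (v s')) *
        inner ℝ (EuclideanSpace.basisFun _ ℝ i) (v s) := fun i => by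
    rw [← Function.update_eq_self s v, inner_elem_update, Function.update_eq_self, mul_comm]
    rfl
  simp only [contractExcept, _root_.sum_apply, ContinuousLinearMap.smulRight_apply,
    innerSL_apply_apply, h, mul_smul]
  rw [← smul_sum, OrthonormalBasis.sum_repr']

/-- Near a point `A` of the Segre-Veronese manifold there is a map that fixes the points of the
manifold and whose derivative at `A` takes values in the tangent space. -/
theorem exists_retraction {n d : Fin K → ℕ} (hd : ∀ k, 1 ≤ d k) {α : ℝ} (hα : α ≠ 0)
    {a : (k : Fin K) → EuclideanSpace ℝ (Fin (n k))} (ha : ∀ k, ‖a k‖ = 1) :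
    ∃ (P : MixedTensor n d → MixedTensor n d) (P' : MixedTensor n d →L[ℝ] MixedTensor n d),
      HasStrictFDerivAt P P' (α • elem n d (diagFamily d a)) ∧
      (∀ᶠ X in 𝓝 (α • elem n d (diagFamily d a)), X ∈ segreVeronese n d → P X = X) ∧
      ∀ X, ∃ p, P' X = tangentVec d α a p := by
  set A := α • elem n d (diagFamily d a) with hA
  set f : MixedTensor n d →L[ℝ] ℝ := innerSL ℝ (elem n d (diagFamily d a))
  set b : (k : Fin K) → MixedTensor n d →L[ℝ] EuclideanSpace ℝ (Fin (n k)) :=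
    fun k => contractExcept a (⟨k, ⟨0, hd k⟩⟩ : Slot d)
  have haa : ∀ k, inner ℝ (a k) (a k) = 1 := fun k => by
    rw [real_inner_self_eq_norm_sq, ha, one_pow]
  have hf : ∀ (β : ℝ) (x : (k : Fin K) → EuclideanSpace ℝ (Fin (n k))),
      f (β • elem n d (diagFamily d x)) = β * ∏ s : Slot d, inner ℝ (a s.1) (x s.1) :=
    fun β x => by
      rw [map_smul, innerSL_apply_apply, inner_elem, smul_eq_mul]
      rfl
  -- Contracting a rank-one tensor in all slots but one recovers `x k` up to a scalar. The identity
  -- is kept free of division, so it needs no nonvanishing hypothesis.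
  have hb : ∀ (β : ℝ) (x : (k : Fin K) → EuclideanSpace ℝ (Fin (n k))) (k : Fin K),
      inner ℝ (a k) (x k) • b k (β • elem n d (diagFamily d x)) =
        f (β • elem n d (diagFamily d x)) • x k := fun β x k => by
    rw [hf, map_smul, contractExcept_elem, smul_smul, diagFamily, smul_smul,
      ← mul_prod_erase univ _ (mem_univ (⟨k, ⟨0, hd k⟩⟩ : Slot d))]
    congr 1
    simp only [diagFamily]
    ring
  have hfA : f A = α := by
    rw [hA, hf, prod_eq_one fun s _ => haa s.1, mul_one]
  have hbA : ∀ k, (f A)⁻¹ • b k A = a k := fun k => by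
    have := hb α a k
    rw [haa, one_smul, ← hA] at this
    rw [this, inv_smul_smul₀ (hfA ▸ hα)]
  set g : MixedTensor n d → (k : Fin K) → EuclideanSpace ℝ (Fin (n k)) :=
    fun X k => (f X)⁻¹ • b k X
  have hgA : g A = a := funext hbA
  have hg : HasStrictFDerivAt g (fderiv ℝ g A) A := by
    refine ContDiffAt.hasStrictFDerivAt (n := 1) ?_ one_ne_zero
    rw [contDiffAt_pi]
    intro k
    exact (f.contDiff.contDiffAt.inv (hfA ▸ hα)).smul (b k).contDiff.contDiffAt
  set D : ((k : Fin K) → EuclideanSpace ℝ (Fin (n k))) →L[ℝ]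
      ((s : Slot d) → EuclideanSpace ℝ (Fin (n s.1))) :=
    ContinuousLinearMap.pi fun s => ContinuousLinearMap.proj s.1
  have hE : HasStrictFDerivAt (fun X => elem n d (D (g X)))
      (((elem n d).linearDeriv (D (g A))).comp (D.comp (fderiv ℝ g A))) A :=
    ((elem n d).hasStrictFDerivAt (D (g A))).comp A (D.hasStrictFDerivAt.comp A hg)
  refine ⟨fun X => f X • elem n d (D (g X)), _, f.hasStrictFDerivAt.smul hE, ?_, fun X =>
    ⟨(f X, fderiv ℝ g A X), ?_⟩⟩
  · have hne : ∀ᶠ X in 𝓝 A, f X ≠ 0 := f.continuous.continuousAt.eventually_ne (hfA ▸ hα)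
    filter_upwards [hne] with X hX
    rintro ⟨β, x, hβ, hx, rfl⟩
    rw [rankOneTensor_eq] at hX ⊢
    have hprod : ∏ s : Slot d, inner ℝ (a s.1) (x s.1) ≠ 0 := fun h => hX (by rw [hf, h, mul_zero])
    have hax : ∀ s : Slot d, inner ℝ (a s.1) (x s.1) ≠ 0 := fun s =>
      prod_ne_zero_iff.1 hprod s (mem_univ s)
    -- Here `g` recovers `x k` divided by `⟪a k, x k⟫`; the product of these scalars over all slots
    -- cancels against `f`, leaving `β`.
    have hDg : D (g (β • elem n d (diagFamily d x))) =
        fun s => (inner ℝ (a s.1) (x s.1))⁻¹ • diagFamily d x s := by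
      ext1 s
      change (f _)⁻¹ • b s.1 _ = _
      rw [inv_smul_eq_iff₀ hX, smul_comm, ← inv_smul_eq_iff₀ (inv_ne_zero (hax s)), inv_inv]
      exact hb β x s.1
    rw [hDg, (elem n d).map_smul_univ, hf, prod_inv_distrib, smul_smul, mul_assoc,
      mul_inv_cancel₀ hprod, mul_one]
  -- The product rule at `A`, where `f A = α` and `g A = a`, gives exactly a `tangentVec`.
  · simp only [_root_.add_apply, _root_.smul_apply, ContinuousLinearMap.comp_apply,
      ContinuousLinearMap.smulRight_apply, ContinuousMultilinearMap.linearDeriv_apply, hgA, hfA]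
    rw [tangentVec, add_comm]
    rfl

theorem hasDerivAt_smul_elem {n d : Fin K → ℕ} (α : ℝ)
    (a : (k : Fin K) → EuclideanSpace ℝ (Fin (n k)))
    (p : ℝ × ((k : Fin K) → EuclideanSpace ℝ (Fin (n k)))) :
    HasDerivAt (fun τ : ℝ => (α + τ * p.1) • elem n d (diagFamily d (a + τ • p.2)))
      (tangentVec d α a p) 0 := by
  have h1 : HasDerivAt (fun τ : ℝ => α + τ * p.1) p.1 0 := by
    simpa using ((hasDerivAt_id (0 : ℝ)).mul_const p.1).const_add α
  have h2 : HasDerivAt (fun τ : ℝ => diagFamily d (a + τ • p.2)) (diagFamily d p.2) 0 := by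
    rw [hasDerivAt_pi]
    intro s
    simpa [diagFamily] using ((hasDerivAt_id (0 : ℝ)).smul_const (p.2 s.1)).const_add (a s.1)
  have h3 := ((elem n d).hasFDerivAt (diagFamily d (a + (0 : ℝ) • p.2))).comp_hasDerivAt
    (0 : ℝ) h2
  refine (h1.smul h3).congr_deriv ?_
  rw [zero_mul, add_zero, Function.comp_apply, zero_smul, add_zero,
    ContinuousMultilinearMap.linearDeriv_apply, tangentVec, add_comm]
  rfl

theorem eventually_smul_elem_mem_segreVeronese {n d : Fin K → ℕ} {α : ℝ} (hα : α ≠ 0)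
    {a : (k : Fin K) → EuclideanSpace ℝ (Fin (n k))} (ha : ∀ k, ‖a k‖ = 1)
    (p : ℝ × ((k : Fin K) → EuclideanSpace ℝ (Fin (n k)))) :
    ∀ᶠ τ in 𝓝 (0 : ℝ),
      (α + τ * p.1) • elem n d (diagFamily d (a + τ • p.2)) ∈ segreVeronese n d := by
  have h1 : ∀ᶠ τ in 𝓝 (0 : ℝ), α + τ * p.1 ≠ 0 :=
    ContinuousAt.eventually_ne (by fun_prop) (by simpa using hα)
  have h2 : ∀ k, ∀ᶠ τ in 𝓝 (0 : ℝ), a k + τ • p.2 k ≠ 0 := fun k => by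
    refine ContinuousAt.eventually_ne (by fun_prop) ?_
    rw [zero_smul, add_zero]
    exact norm_ne_zero_iff.1 (by simp [ha])
  filter_upwards [h1, Filter.eventually_all.2 h2] with τ hτ1 hτ2
  exact smul_elem_mem_segreVeronese hτ1 hτ2

variable {n d : Fin K → ℕ} {α : Fin R → ℝ} {a : Fin R → (k : Fin K) → EuclideanSpace ℝ (Fin (n k))}

theorem TerraciniBound.condNumber_le (hd : ∀ k, 1 ≤ d k) (hα : ∀ r, α r ≠ 0)
    (ha : ∀ r k, ‖a r k‖ = 1) {c : ℝ} (hc : 0 < c) (h : TerraciniBound d α a (c ^ 2)) :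
    condNumber (segreVeronese n d)
        (WithLp.toLp 2 fun r => α r • elem n d (diagFamily d (a r))) ≤
      ENNReal.ofReal (1 / c) := by
  choose P P' hP hfix hT using fun r => exists_retraction hd (hα r) (ha r)
  refine condNumber_le_of_hasStrictFDerivAt (fun r => ?_) hP hfix hc fun v => ?_
  · exact smul_elem_mem_segreVeronese (hα r) fun k => norm_ne_zero_iff.1 (by simp [ha])
  · choose p hp using fun r => hT r (v r)
    refine (sq_le_sq₀ (by positivity) (norm_nonneg _)).1 ?_
    rw [mul_pow, PiLp.norm_sq_eq_of_L2]
    simp only [hp]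
    exact h p

/-- Every tangent vector is the velocity of a line in the parameters `(α, a)`, along which the
condition number limits how much the sum can shrink. -/
theorem terraciniBound_of_condNumber_lt (hα : ∀ r, α r ≠ 0) (ha : ∀ r k, ‖a r k‖ = 1) {C : ℝ}
    (h : condNumber (segreVeronese n d)
      (WithLp.toLp 2 fun r => α r • elem n d (diagFamily d (a r))) < ENNReal.ofReal C) :
    TerraciniBound d α a (C⁻¹ ^ 2) := by
  have hC : 0 < C := ENNReal.ofReal_pos.1 (pos_of_gt h)
  intro p
  rw [inv_pow, inv_mul_le_iff₀ (by positivity)]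
  exact sum_norm_deriv_sq_le_of_condNumber_lt h
    (fun r => hasDerivAt_smul_elem (α r) (a r) (p r))
    (fun r => by rw [zero_mul, add_zero, zero_smul, add_zero])
    fun r => eventually_smul_elem_mem_segreVeronese (hα r) (ha r) (p r)

end Terracini

/-! ### Comparison of the condition numbers -/

/-- A comparison of extended nonnegative numbers by means of their finite strict upper bounds. -/
theorem le_ofReal_mul_of_forall_lt {x y : ℝ≥0∞} {b : ℝ} (hb : 0 < b)
    (h : ∀ C : ℝ, 0 < C → y < ENNReal.ofReal C → x ≤ ENNReal.ofReal (b * C)) :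
    x ≤ ENNReal.ofReal b * y := by
  rw [mul_comm, ← ENNReal.div_le_iff_le_mul (Or.inl (ENNReal.ofReal_pos.2 hb).ne')
    (Or.inl ENNReal.ofReal_ne_top)]
  refine le_of_forall_gt_imp_ge_of_dense fun z hz => ?_
  rcases eq_or_ne z ∞ with rfl | hz'
  · exact le_top
  · have hzpos : 0 < z.toReal := ENNReal.toReal_pos (pos_of_gt hz).ne' hz'
    have h1 := h z.toReal hzpos (by rwa [ENNReal.ofReal_toReal hz'])
    rw [ENNReal.ofReal_mul hb.le, ENNReal.ofReal_toReal hz', mul_comm] at h1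
    exact ENNReal.div_le_of_le_mul h1

/-- Among the isometric images of a decomposition, those in strictly larger ambient spaces have the
greatest condition number. -/
theorem condNumber_multilinearMul_le {K R : ℕ} {d m n l : Fin K → ℕ} (hd : ∀ k, 1 ≤ d k)
    {G : Fin R → MixedTensor m d} (hG : ∀ r, G r ∈ segreVeronese m d)
    {Q : (k : Fin K) → Matrix (Fin (n k)) (Fin (m k)) ℝ} (hQ : ∀ k, (Q k)ᵀ * Q k = 1)
    {U : (k : Fin K) → Matrix (Fin (l k)) (Fin (m k)) ℝ} (hU : ∀ k, (U k)ᵀ * U k = 1)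
    (hml : ∀ k, m k < l k) :
    condNumber (segreVeronese n d) (WithLp.toLp 2 fun r => multilinearMul d Q (G r)) ≤
      condNumber (segreVeronese l d) (WithLp.toLp 2 fun r => multilinearMul d U (G r)) := by
  choose α a hα ha hGr using hG
  obtain rfl : G = fun r => α r • elem m d (diagFamily d (a r)) :=
    funext fun r => (hGr r).trans (rankOneTensor_eq m d (α r) (a r))
  have hmap : ∀ {q : Fin K → ℕ} {V : (k : Fin K) → Matrix (Fin (q k)) (Fin (m k)) ℝ},
      (∀ k, (V k)ᵀ * V k = 1) → ∀ r k, ‖mulFamily V (a r) k‖ = 1 := fun hV r k => by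
    rw [norm_eq_sqrt_real_inner, inner_mulFamily hV, ← norm_eq_sqrt_real_inner, ha]
  simp only [multilinearMul_rankOne]
  rw [← one_mul (condNumber (segreVeronese l d) _), ← ENNReal.ofReal_one]
  refine le_ofReal_mul_of_forall_lt one_pos fun C hC h => ?_
  have hT := terraciniBound_of_condNumber_lt hα (hmap hU) h
  rw [one_mul, ← inv_inv C, ← one_div C⁻¹]
  -- The bound in the larger space descends to `G` and yields all Gram bounds with the same
  -- constant; together they lift along `Q`.
  exact ((hT.of_map hU).map ha hQ fun s =>
    hT.gramBound_of_lt hα ha hU (sq_nonneg _) s (hml s.1)).condNumber_le hd hα (hmap hQ)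
      (inv_pos.2 hC)

theorem condNumber_multilinearMul_le_sqrt_mul {K R : ℕ} (hK : 1 ≤ K) {d m n : Fin K → ℕ}
    (hd : ∀ k, 1 ≤ d k) {G : Fin R → MixedTensor m d} (hG : ∀ r, G r ∈ segreVeronese m d)
    {Q : (k : Fin K) → Matrix (Fin (n k)) (Fin (m k)) ℝ} (hQ : ∀ k, (Q k)ᵀ * Q k = 1) :
    condNumber (segreVeronese n d) (WithLp.toLp 2 fun r => multilinearMul d Q (G r)) ≤
      ENNReal.ofReal (Real.sqrt (Finset.univ.sup d : ℕ)) *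
        condNumber (segreVeronese m d) (WithLp.toLp 2 G) := by
  choose α a hα ha hGr using hG
  obtain rfl : G = fun r => α r • elem m d (diagFamily d (a r)) :=
    funext fun r => (hGr r).trans (rankOneTensor_eq m d (α r) (a r))
  have hmap : ∀ r k, ‖mulFamily Q (a r) k‖ = 1 := fun r k => by
    rw [norm_eq_sqrt_real_inner, inner_mulFamily hQ, ← norm_eq_sqrt_real_inner, ha]
  simp only [multilinearMul_rankOne]
  set D : ℕ := Finset.univ.sup d
  have hdD : ∀ k, d k ≤ D := fun k => Finset.le_sup (Finset.mem_univ k)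
  have hD1 : (1 : ℝ) ≤ D := Nat.one_le_cast.2 ((hd ⟨0, hK⟩).trans (hdD _))
  have hD : (0 : ℝ) < D := one_pos.trans_le hD1
  refine le_ofReal_mul_of_forall_lt (Real.sqrt_pos.2 hD) fun C hC h => ?_
  have hT := terraciniBound_of_condNumber_lt hα ha h
  have hpos : 0 < √(D : ℝ) * C := mul_pos (Real.sqrt_pos.2 hD) hC
  have hsq : (√(D : ℝ) * C)⁻¹ ^ 2 = C⁻¹ ^ 2 / D := by
    rw [inv_pow, mul_pow, Real.sq_sqrt hD.le, mul_inv_rev, inv_pow, div_eq_mul_inv]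
  rw [← inv_inv (√(D : ℝ) * C), ← one_div (√(D : ℝ) * C)⁻¹]
  refine TerraciniBound.condNumber_le hd hα hmap (inv_pos.2 hpos) ?_
  rw [hsq]
  -- With `D = max d`, the tangent bound `C⁻¹ ^ 2` and the Gram bounds `C⁻¹ ^ 2 / d k` are all
  -- weakened to the common constant `C⁻¹ ^ 2 / D`.
  refine (hT.mono (div_le_self (sq_nonneg _) hD1)).map ha hQ fun s =>
    (hT.gramBound hα ha (sq_nonneg _) s).mono ?_
  exact div_le_div_of_nonneg_left (sq_nonneg _) (Nat.cast_pos.2 (hd _)) (Nat.cast_le.2 (hdD _))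

end

theorem theorem2 (K R : ℕ) (hK : 1 ≤ K) (d m n : Fin K → ℕ) (hd : ∀ k, 1 ≤ d k)
    (G : Fin R → MixedTensor m d) (hG : ∀ r, G r ∈ segreVeronese m d)
    (Q : (k : Fin K) → Matrix (Fin (n k)) (Fin (m k)) ℝ) (hQ : ∀ k, (Q k)ᵀ * Q k = 1) :
    condNumber (segreVeronese n d) (WithLp.toLp 2 fun r => multilinearMul d Q (G r)) ≤
        ENNReal.ofReal (Real.sqrt (Finset.univ.sup d : ℕ)) *
          condNumber (segreVeronese m d) (WithLp.toLp 2 G) ∧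
      ∀ (l : Fin K → ℕ) (U : (k : Fin K) → Matrix (Fin (l k)) (Fin (m k)) ℝ),
        (∀ k, (U k)ᵀ * U k = 1) → (∀ k, m k < min (l k) (n k)) →
          condNumber (segreVeronese n d) (WithLp.toLp 2 fun r => multilinearMul d Q (G r)) =
            condNumber (segreVeronese l d) (WithLp.toLp 2 fun r => multilinearMul d U (G r)) := by
  -- Both ambient spaces are strictly larger than that of `G`, so each condition number dominates
  -- the other.
  refine ⟨condNumber_multilinearMul_le_sqrt_mul hK hd hG hQ, fun l U hU hlt => le_antisymm ?_ ?_⟩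
  · exact condNumber_multilinearMul_le hd hG hQ hU fun k => (lt_min_iff.1 (hlt k)).1
  · exact condNumber_multilinearMul_le hd hG hU hQ fun k => (lt_min_iff.1 (hlt k)).2
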